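/- Let $\lambda>0$, $a>0$, $\delta_{\max}\ge 0$ be real numbers, let $k\ge 1$ be an integer, and put $b=\frac a2+1$ and $d=\lambda\pi\delta_{\max}^2$. For $s>0$, $x\ge 0$ let $\Gamma(s,x)=\int_x^\infty z^{s-1}e^{-z}\,dz$, $\Gamma(s)=\Gamma(s,0)$ and $\gamma(s,x)=\Gamma(s)-\Gamma(s,x)$. Caches are placed in the plane $\mathbb R^2$ as a homogeneous Poisson process of intensity $\lambda$, and a client is located at a fixed point of the plane. The cost of contacting $k$ caches at distances $\delta_1,\dots,\delta_k$ from the client is $$W(\delta_1,\dots,\delta_k)=\sum_{i=1}^k\min\{\delta_i^a,\delta_{\max}^a\}.$$ (i) (Partitioning.) Suppose that each cache independently receives a label chosen uniformly at random from $\{1,\dots,k\}$, independently of the positions of the caches, and that for each $t\in\{1,\dots,k\}$ the client contacts the nearest cache with label $t$. Then the expected cost $W^p$ of contacting these $k$ caches is finite and equals $$W^p=k\left(\frac{k}{\lambda\pi}\right)^{b-1}\gamma\left(b,\frac dk\right)+k\left(\frac{d}{\lambda\pi}\right)^{b-1}\Gamma\left(1,\frac dk\right).$$ (ii) (Lower bound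 for coding.) Let $D(i)$ be the distance from the client to the $i$-th nearest cache. Then the minimum expected cost $W^c_{\min}=\mathbb E\left[W(D(1),\dots,D(k))\right]$, i.e. the expected cost of contacting the $k$ nearest caches, is finite and equals $$W^c_{\min}=\frac{\gamma(k+b,d)+b\,d^{b-1}\,\Gamma(k+1,d)-(b-1)\,d^{b}\,\Gamma(k,d)}{(\lambda\pi)^{b-1}\,b\,\Gamma(k)}.$$ -/

import Mathlib

open MeasureTheory ProbabilityTheory
open scoped ENNReal

noncomputable section

namespace WirelessCaches

/-- The Euclidean plane; `volume` on it is the area measure. -/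
abbrev Plane : Type := EuclideanSpace ℝ (Fin 2)

/-- The upper incomplete Gamma function `Γ(s, x) = ∫_x^∞ z^(s-1) e^(-z) dz`. -/
def upperGamma (s x : ℝ) : ℝ := ∫ z in Set.Ioi x, z ^ (s - 1) * Real.exp (-z)

/-- The lower incomplete Gamma function `γ(s, x) = Γ(s) - Γ(s, x)`. -/
def lowerGamma (s x : ℝ) : ℝ := Real.Gamma s - upperGamma s x

/-- The random counting measure of a sequence of random points of the plane:
`pointCount X ω B` is the number of indices `n` with `X n ω ∈ B` (for Borel `B`). -/
def pointCount {Ω : Type*} (X : ℕ → Ω → Plane) (ω : Ω) : Measure Plane :=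
  Measure.sum fun n => Measure.dirac (X n ω)

/-- The random points `X 0, X 1, …` (enumerated in an arbitrary measurable way) form a homogeneous
Poisson process of intensity `lam`: the number of points in a Borel set of finite area is Poisson
distributed with mean `lam * area`, and the numbers of points in pairwise disjoint Borel sets are
independent. -/
structure IsHomogeneousPoisson {Ω : Type*} [MeasurableSpace Ω] (P : Measure Ω)
    (X : ℕ → Ω → Plane) (lam : ℝ) : Prop where
  measurable : ∀ n, Measurable (X n)
  poisson : ∀ B : Set Plane, MeasurableSet B → volume B ≠ ∞ →
    HasLaw (fun ω => pointCount X ω B)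
      ((poissonMeasure (ENNReal.ofReal lam * volume B).toNNReal).map (Nat.cast : ℕ → ℝ≥0∞)) P
  indep : ∀ (m : ℕ) (B : Fin m → Set Plane), (∀ i, MeasurableSet (B i)) →
    Pairwise (Function.onFun Disjoint B) →
    iIndepFun (fun i ω => pointCount X ω (B i)) P

/-- Random labelling of the caches: the cache at `X n` gets the label `L n`; the labels are uniform
on a set of `k` labels, independent of each other and of the positions of the caches. -/
structure IsUniformLabelling {Ω : Type*} [MeasurableSpace Ω] (P : Measure Ω)
    (X : ℕ → Ω → Plane) {k : ℕ} (L : ℕ → Ω → Fin k) : Prop where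
  measurable : ∀ n, Measurable (L n)
  uniform : ∀ (n : ℕ) (t : Fin k), P {ω | L n ω = t} = (k : ℝ≥0∞)⁻¹
  indep : iIndepFun L P
  indep_position : IndepFun (fun ω n => X n ω) (fun ω n => L n ω) P

/-- `nearestDist X c i ω` is the distance from the client at `c` to the `i`-th nearest cache
(`i ≥ 1`): the least radius `r` such that at least `i` caches are within distance `r`. -/
def nearestDist {Ω : Type*} (X : ℕ → Ω → Plane) (c : Plane) (i : ℕ) (ω : Ω) : ℝ :=
  sInf {r : ℝ | (i : ℝ≥0∞) ≤ pointCount X ω (Metric.closedBall c r)}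

/-- `labelDist X L c t ω` is the distance from the client at `c` to the nearest cache with
label `t`. -/
def labelDist {Ω : Type*} {k : ℕ} (X : ℕ → Ω → Plane) (L : ℕ → Ω → Fin k) (c : Plane)
    (t : Fin k) (ω : Ω) : ℝ :=
  Metric.infDist c {y | ∃ n, L n ω = t ∧ X n ω = y}

/-- The cost `W(δ₁, …, δₖ) = ∑ᵢ min (δᵢ ^ a) (δmax ^ a)` of contacting caches at
distances `δ₁, …, δₖ`. -/
def waitingCost {k : ℕ} (a δmax : ℝ) (δ : Fin k → ℝ) : ℝ :=
  ∑ i, min (δ i ^ a) (δmax ^ a)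

/-- The random cost of the partitioning (uncoded) strategy: for each label the client contacts
the nearest cache with that label. -/
def partitionCost {Ω : Type*} {k : ℕ} (X : ℕ → Ω → Plane) (L : ℕ → Ω → Fin k) (c : Plane)
    (a δmax : ℝ) (ω : Ω) : ℝ :=
  waitingCost a δmax fun t : Fin k => labelDist X L c t ω

/-- The random cost of contacting the `k` nearest caches. -/
def nearestCost {Ω : Type*} (X : ℕ → Ω → Plane) (c : Plane) (k : ℕ) (a δmax : ℝ) (ω : Ω) : ℝ :=
  waitingCost a δmax fun i : Fin k => nearestDist X c ((i : ℕ) + 1) ω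

end WirelessCaches

end

noncomputable section

namespace WirelessCaches

open Filter Set Topology

/-! Both costs are sums of truncated powers of single distances, so by linearity only the tail of
each distance matters, never their joint law. The `i`-th nearest cache is at distance at least `r`
exactly when the open ball of radius `r` holds fewer than `i` caches, up to a null event; this
Poisson probability is `Γ(i, λπr²)/Γ(i)`. For partitioning, thinning by labels gives the tail
`exp(-λπr²/k)`, which is the same formula with `i = 1` and intensity `λ/k`.

One computation, `integral_min_rpow_of_tail`, therefore serves both parts: the layer-cake formula
turns the expectation into `∫₀ᵈ β u^(β-1) Γ(i, u) du` with `β = a/2`, which has an explicit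
antiderivative. For coding, the resulting sum over `i` collapses by the recurrences of the
incomplete Gamma functions (`sum_lowerGamma_add_upperGamma`). -/

/-! ### Incomplete Gamma functions. -/

lemma integrableOn_gammaIntegrand {s : ℝ} (hs : 0 < s) :
    IntegrableOn (fun z : ℝ => z ^ (s - 1) * Real.exp (-z)) (Ioi 0) := by
  simpa only [mul_comm] using Real.GammaIntegral_convergent hs

lemma intervalIntegrable_gammaIntegrand {s : ℝ} (hs : 0 < s) {x : ℝ} (hx : 0 ≤ x) :
    IntervalIntegrable (fun z : ℝ => z ^ (s - 1) * Real.exp (-z)) volume 0 x :=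
  (intervalIntegrable_iff_integrableOn_Ioc_of_le hx).2
    ((integrableOn_gammaIntegrand hs).mono_set Ioc_subset_Ioi_self)

lemma lowerGamma_eq_integral {s : ℝ} (hs : 0 < s) {x : ℝ} (hx : 0 ≤ x) :
    lowerGamma s x = ∫ z in (0 : ℝ)..x, z ^ (s - 1) * Real.exp (-z) := by
  have h := intervalIntegral.integral_interval_add_Ioi (intervalIntegrable_gammaIntegrand hs hx
    |>.1.union (integrableOn_gammaIntegrand hs) |>.mono_set subset_union_right)
    ((integrableOn_gammaIntegrand hs).mono_set (Ioi_subset_Ioi hx))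
  rw [lowerGamma, upperGamma, Real.Gamma_eq_integral hs]
  simp only [mul_comm (Real.exp _)]
  linarith

lemma upperGamma_eq_sub {s : ℝ} (hs : 0 < s) {x : ℝ} (hx : 0 ≤ x) :
    upperGamma s x = Real.Gamma s - ∫ z in (0 : ℝ)..x, z ^ (s - 1) * Real.exp (-z) := by
  rw [← lowerGamma_eq_integral hs hx, lowerGamma]; ring

lemma upperGamma_zero_right {s : ℝ} (hs : 0 < s) : upperGamma s 0 = Real.Gamma s := by
  simp [upperGamma_eq_sub hs le_rfl]

lemma upperGamma_nonneg (s : ℝ) {x : ℝ} (hx : 0 ≤ x) : 0 ≤ upperGamma s x :=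
  setIntegral_nonneg measurableSet_Ioi fun _ hz =>
    mul_nonneg (Real.rpow_nonneg (hx.trans (le_of_lt hz)) _) (Real.exp_pos _).le

lemma upperGamma_one (x : ℝ) : upperGamma 1 x = Real.exp (-x) := by
  simp only [upperGamma, sub_self, Real.rpow_zero, one_mul, integral_exp_neg_Ioi]

lemma hasDerivAt_upperGamma {s : ℝ} (hs : 0 < s) {x : ℝ} (hx : 0 < x) :
    HasDerivAt (upperGamma s) (-(x ^ (s - 1) * Real.exp (-x))) x := by
  have hc : ContinuousAt (fun z : ℝ => z ^ (s - 1) * Real.exp (-z)) x :=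
    (Real.continuousAt_rpow_const _ _ (Or.inl hx.ne')).mul (by fun_prop)
  have h := (intervalIntegral.integral_hasDerivAt_right
    (intervalIntegrable_gammaIntegrand hs hx.le)
    (Measurable.stronglyMeasurable (by fun_prop)).stronglyMeasurableAtFilter hc).const_sub
      (Real.Gamma s)
  refine h.congr_of_eventuallyEq ?_
  filter_upwards [lt_mem_nhds hx] with y hy using upperGamma_eq_sub hs hy.le

lemma continuousOn_upperGamma {s : ℝ} (hs : 0 < s) : ContinuousOn (upperGamma s) (Ici 0) := by
  intro x hx
  have hx' : (0 : ℝ) ≤ x + 1 := by have := mem_Ici.1 hx; linarith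
  have h : ContinuousOn (upperGamma s) (Icc 0 (x + 1)) := by
    have := (intervalIntegral.continuousOn_primitive_interval'
      (intervalIntegrable_gammaIntegrand hs hx') left_mem_uIcc)
    rw [uIcc_of_le hx'] at this
    exact (continuousOn_const.sub this).congr fun y hy => upperGamma_eq_sub hs hy.1
  refine (h x ⟨hx, by linarith⟩).mono_of_mem_nhdsWithin ?_
  rw [← Ici_inter_Iic]
  exact inter_mem self_mem_nhdsWithin (mem_nhdsWithin_of_mem_nhds (Iic_mem_nhds (by linarith)))

/-- Integration by parts in disguise: the difference of the two sides has derivative zero in `x`,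
and at `0` the claim is the functional equation of `Γ`. -/
lemma upperGamma_add_one {s : ℝ} (hs : 0 < s) {x : ℝ} (hx : 0 ≤ x) :
    upperGamma (s + 1) x = s * upperGamma s x + x ^ s * Real.exp (-x) := by
  have hs1 : 0 < s + 1 := by linarith
  have key : ∀ y ∈ Icc 0 x, upperGamma (s + 1) y - s * upperGamma s y - y ^ s * Real.exp (-y) =
      upperGamma (s + 1) 0 - s * upperGamma s 0 - 0 ^ s * Real.exp (-0) := by
    intro y hy
    have hcont : ContinuousOn
        (fun y => upperGamma (s + 1) y - s * upperGamma s y - y ^ s * Real.exp (-y)) (Icc 0 y) := by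
      refine ContinuousOn.sub (ContinuousOn.sub ?_ (continuousOn_const.mul ?_)) (ContinuousOn.mul ?_ ?_)
      · exact (continuousOn_upperGamma hs1).mono Icc_subset_Ici_self
      · exact (continuousOn_upperGamma hs).mono Icc_subset_Ici_self
      · exact (Real.continuous_rpow_const hs.le).continuousOn
      · fun_prop
    have h0 := intervalIntegral.integral_eq_sub_of_hasDerivAt_of_le (f' := fun _ => (0 : ℝ)) hy.1
      hcont (fun z hz => by
        have hz0 : 0 < z := hz.1
        have h1 := hasDerivAt_upperGamma hs1 hz0
        have h2 := (hasDerivAt_upperGamma hs hz0).const_mul s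
        have h3 := (Real.hasDerivAt_rpow_const (p := s) (Or.inl hz0.ne')).mul
          ((Real.hasDerivAt_exp (-z)).comp z (hasDerivAt_neg z))
        refine ((h1.sub h2).sub h3).congr_deriv ?_
        simp only [add_sub_cancel_right, Function.comp_apply]
        ring) (by simp)
    simp only [intervalIntegral.integral_zero] at h0
    linarith
  have h := key x ⟨hx, le_rfl⟩
  rw [upperGamma_zero_right hs, upperGamma_zero_right hs1, Real.Gamma_add_one hs.ne',
    Real.zero_rpow hs.ne'] at h
  linarith

lemma lowerGamma_add_one {s : ℝ} (hs : 0 < s) {x : ℝ} (hx : 0 ≤ x) :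
    lowerGamma (s + 1) x = s * lowerGamma s x - x ^ s * Real.exp (-x) := by
  simp only [lowerGamma, upperGamma_add_one hs hx, Real.Gamma_add_one hs.ne']
  ring

/-- Iterating the recurrence adds one Poisson weight per step; the result is the probability that a
Poisson variable of mean `x` is less than `i`. -/
lemma upperGamma_natCast_div {i : ℕ} (hi : 1 ≤ i) {x : ℝ} (hx : 0 ≤ x) :
    upperGamma i x / Real.Gamma i =
      ∑ j ∈ Finset.range i, Real.exp (-x) * x ^ j / (j.factorial : ℝ) := by
  induction i, hi using Nat.le_induction with
  | base => simp [upperGamma_one]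
  | succ n hn ih =>
    have hn0 : (0 : ℝ) < n := by exact_mod_cast hn
    have hG := (Real.Gamma_pos_of_pos hn0).ne'
    rw [Finset.sum_range_succ, ← ih]
    push_cast
    rw [upperGamma_add_one hn0 hx, ← Real.Gamma_nat_eq_factorial, Real.Gamma_add_one hn0.ne',
      Real.rpow_natCast]
    field_simp

lemma tendsto_upperGamma_natCast {i : ℕ} (hi : 1 ≤ i) :
    Tendsto (fun x => upperGamma i x / Real.Gamma i) atTop (𝓝 0) := by
  have h : Tendsto (fun x : ℝ => ∑ j ∈ Finset.range i, Real.exp (-x) * x ^ j / (j.factorial : ℝ))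
      atTop (𝓝 (∑ j ∈ Finset.range i, 0 / (j.factorial : ℝ))) := by
    refine tendsto_finsetSum _ fun j _ => Tendsto.div_const ?_ _
    simpa only [mul_comm] using Real.tendsto_pow_mul_exp_neg_atTop_nhds_zero j
  simp only [zero_div, Finset.sum_const_zero] at h
  refine h.congr' ?_
  filter_upwards [eventually_ge_atTop 0] with x hx using (upperGamma_natCast_div hi hx).symm

/-- `β ∫₀ᵈ u^(β-1) Γ(s, u) du = γ(s+β, d) + d^β Γ(s, d)`, together with integrability. -/
lemma integral_upperGamma_mul_rpow {s β d : ℝ} (hs : 0 < s) (hβ : 0 < β) (hd : 0 ≤ d) :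
    IntegrableOn (fun u => upperGamma s u * (β * u ^ (β - 1))) (Ioc 0 d) ∧
    ∫ u in Ioc 0 d, upperGamma s u * (β * u ^ (β - 1)) =
      lowerGamma (s + β) d + d ^ β * upperGamma s d := by
  have hsβ : 0 < s + β := by linarith
  have hcont : ContinuousOn (fun u => u ^ β * upperGamma s u - upperGamma (s + β) u)
      (Icc 0 d) := by
    refine ContinuousOn.sub (ContinuousOn.mul ?_ ?_) ?_
    · exact (Real.continuous_rpow_const hβ.le).continuousOn
    · exact (continuousOn_upperGamma hs).mono Icc_subset_Ici_self
    · exact (continuousOn_upperGamma hsβ).mono Icc_subset_Ici_self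
  -- The derivative of `Γ(s + β, u)` cancels the term where `Γ(s, u)` is differentiated.
  have hderiv : ∀ u ∈ Ioo 0 d, HasDerivAt (fun u => u ^ β * upperGamma s u - upperGamma (s + β) u)
      (upperGamma s u * (β * u ^ (β - 1))) u := by
    intro u hu
    refine (((Real.hasDerivAt_rpow_const (p := β) (Or.inl hu.1.ne')).mul
      (hasDerivAt_upperGamma hs hu.1)).sub (hasDerivAt_upperGamma hsβ hu.1)).congr_deriv ?_
    rw [show s + β - 1 = β + (s - 1) by ring, Real.rpow_add hu.1]
    ring
  -- For `β < 1` the integrand is unbounded near `0`; being a nonnegative derivative of a continuous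
  -- function makes it integrable.
  have hint := intervalIntegral.integrableOn_deriv_of_nonneg hcont hderiv fun u hu =>
    mul_nonneg (upperGamma_nonneg s hu.1.le) (mul_nonneg hβ.le (Real.rpow_nonneg hu.1.le _))
  refine ⟨hint, ?_⟩
  rw [← intervalIntegral.integral_of_le hd, intervalIntegral.integral_eq_sub_of_hasDerivAt_of_le hd
    hcont hderiv ((intervalIntegrable_iff_integrableOn_Ioc_of_le hd).2 hint),
    upperGamma_zero_right hsβ, Real.zero_rpow hβ.ne', lowerGamma]
  ring

/-- Induction on `k`: the recurrences bring the closed form at `n + 1` and the new summand down to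
`γ(n+β+1, d)`, `Γ(n, d)` and `exp (-d)`, where the identity is algebraic. -/
lemma sum_lowerGamma_add_upperGamma {k : ℕ} (hk : 1 ≤ k) {β d : ℝ} (hβ : 0 < β) (hd : 0 ≤ d) :
    ∑ i ∈ Finset.range k, (lowerGamma ((i + 1 : ℕ) + β) d + d ^ β * upperGamma (i + 1 : ℕ) d) /
        Real.Gamma (i + 1 : ℕ) =
      (lowerGamma (k + (β + 1)) d + (β + 1) * d ^ β * upperGamma (k + 1) d -
        β * d ^ (β + 1) * upperGamma k d) / ((β + 1) * Real.Gamma k) := by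
  have hdb : d ^ (β + 1) = d ^ β * d := by
    rw [Real.rpow_add_of_nonneg hd hβ.le zero_le_one, Real.rpow_one]
  induction k, hk using Nat.le_induction with
  | base =>
    have h1 := lowerGamma_add_one (s := 1 + β) (by linarith) hd
    have h2 := upperGamma_add_one (s := 1) one_pos hd
    simp only [Finset.sum_range_one, Nat.zero_add, Nat.cast_one, Real.Gamma_one]
    rw [show (1 : ℝ) + (β + 1) = 1 + β + 1 by ring, h1, h2, upperGamma_one,
      show 1 + β = β + 1 by ring, hdb]
    simp only [Real.rpow_one]
    field_simp
    ring
  | succ n hn ih =>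
    have hn0 : (0 : ℝ) < n := by exact_mod_cast hn
    have hG := (Real.Gamma_pos_of_pos hn0).ne'
    have h1 := lowerGamma_add_one (s := n + (β + 1)) (by linarith) hd
    have h2 := upperGamma_add_one (s := n + 1) (by linarith) hd
    have h3 := upperGamma_add_one hn0 hd
    have h4 : d ^ ((n : ℝ) + (β + 1)) = d ^ (n : ℝ) * d ^ β * d := by
      rw [Real.rpow_add_of_nonneg hd hn0.le (by linarith), hdb]; ring
    have h5 : d ^ ((n : ℝ) + 1) = d ^ (n : ℝ) * d := by
      rw [Real.rpow_add_of_nonneg hd hn0.le zero_le_one, Real.rpow_one]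
    rw [Finset.sum_range_succ, ih]
    push_cast
    rw [show (n : ℝ) + 1 + (β + 1) = n + (β + 1) + 1 by ring,
      show (n : ℝ) + 1 + β = n + (β + 1) by ring, h1, h2, h3, Real.Gamma_add_one hn0.ne', h4, h5,
      hdb]
    field_simp
    ring

/-! ### Truncated moments from tails. -/

/-- Expected truncated power of a random distance `D` whose tail is a regularised incomplete Gamma
function of `c * r ^ 2`. The event `E r` says that the search succeeds within distance `r`, and
`D` may take an arbitrary small value if it never succeeds. -/
lemma integral_min_rpow_of_tail {Ω : Type*} [MeasurableSpace Ω] {P : Measure Ω}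
    [IsProbabilityMeasure P] {D : Ω → ℝ} {E : ℝ → Set Ω} {i : ℕ} (hi : 1 ≤ i) {c : ℝ} (hc : 0 < c)
    (hD : ∀ ω, 0 ≤ D ω) (hE : ∀ r, MeasurableSet (E r))
    (hlt : ∀ r > 0, {ω | D ω < r} = E r ∪ ⋂ n : ℕ, (E n)ᶜ)
    (htail : ∀ r > 0, P (E r)ᶜ = ENNReal.ofReal (upperGamma i (c * r ^ 2) / Real.Gamma i))
    {a δ : ℝ} (ha : 0 < a) (hδ : 0 ≤ δ) :
    Integrable (fun ω => min (D ω ^ a) (δ ^ a)) P ∧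
    ∫ ω, min (D ω ^ a) (δ ^ a) ∂P = c⁻¹ ^ (a / 2) *
      ((lowerGamma (i + a / 2) (c * δ ^ 2) + (c * δ ^ 2) ^ (a / 2) * upperGamma i (c * δ ^ 2)) /
        Real.Gamma i) := by
  have hi0 : (0 : ℝ) < i := by exact_mod_cast hi
  have hG : 0 < Real.Gamma i := Real.Gamma_pos_of_pos hi0
  set β := a / 2 with hβdef
  have hβ : 0 < β := by positivity
  have hmeas : Measurable D := by
    refine measurable_of_Iio fun r => ?_
    rcases le_or_gt r 0 with hr | hr
    · convert MeasurableSet.empty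
      ext ω
      simpa using hr.trans (hD ω)
    · change MeasurableSet {ω | D ω < r}
      rw [hlt r hr]
      exact (hE r).union (MeasurableSet.iInter fun n => (hE n).compl)
  -- The search fails at every radius with probability at most the tail at `n`, which tends to `0`;
  -- the default value of `D` there is harmless.
  have hnull : P (⋂ n : ℕ, (E n)ᶜ) = 0 := by
    have hlim : Tendsto (fun n : ℕ =>
        ENNReal.ofReal (upperGamma i (c * (n : ℝ) ^ 2) / Real.Gamma i)) atTop (𝓝 0) := by
      rw [← ENNReal.ofReal_zero]
      refine (ENNReal.continuous_ofReal.tendsto 0).comp ((tendsto_upperGamma_natCast hi).comp ?_)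
      exact ((tendsto_pow_atTop two_ne_zero).comp tendsto_natCast_atTop_atTop).const_mul_atTop hc
    refine le_antisymm (ge_of_tendsto hlim ?_) zero_le
    filter_upwards [eventually_gt_atTop 0] with n hn
    rw [← htail n (by exact_mod_cast hn)]
    exact measure_mono (iInter_subset _ n)
  have htailD : ∀ r > 0, P {ω | r ≤ D ω} =
      ENNReal.ofReal (upperGamma i (c * r ^ 2) / Real.Gamma i) := by
    intro r hr
    have h1 : {ω | r ≤ D ω} = {ω | D ω < r}ᶜ := by ext; simp
    rw [h1, hlt r hr, compl_union, ← htail r hr]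
    exact measure_inter_conull (by simpa using hnull)
  set d := c * δ ^ 2 with hd_def
  have hd : 0 ≤ d := by positivity
  -- Rescaled squared distance, capped at `d`: the cost is a constant times `V ^ β`, and the tail of
  -- `V` at `t ≤ d` is `Γ(i, t)/Γ(i)`.
  let V : Ω → ℝ := fun ω => min (c * D ω ^ 2) d
  have hV0 : ∀ ω, 0 ≤ V ω := fun ω => le_min (mul_nonneg hc.le (sq_nonneg _)) hd
  have hVm : Measurable V := by fun_prop
  have hpow : ∀ x : ℝ, 0 ≤ x → (c * x ^ 2) ^ β = c ^ β * x ^ a := by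
    intro x hx
    rw [Real.mul_rpow hc.le (sq_nonneg _), ← Real.rpow_natCast, ← Real.rpow_mul hx]
    congr 2
    rw [hβdef]; push_cast; ring
  have hmono : MonotoneOn (fun x : ℝ => x ^ β) (Ici 0) := fun x hx y _ hxy =>
    Real.rpow_le_rpow hx hxy hβ.le
  have hcβ : c⁻¹ ^ β * c ^ β = 1 := by
    rw [← Real.mul_rpow (by positivity) hc.le, inv_mul_cancel₀ hc.ne', Real.one_rpow]
  have hminV : ∀ ω, min (D ω ^ a) (δ ^ a) = c⁻¹ ^ β * V ω ^ β := by
    intro ω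
    have h := hmono.map_min (a := c * D ω ^ 2) (b := d)
      (mem_Ici.2 (mul_nonneg hc.le (sq_nonneg _))) (mem_Ici.2 hd)
    change V ω ^ β = _ at h
    simp only [hd_def] at h
    rw [h, hpow _ (hD ω), hpow _ hδ, ← mul_min_of_nonneg _ _ (Real.rpow_nonneg hc.le β),
      ← mul_assoc, hcβ, one_mul]
  have hVint : Integrable (fun ω => V ω ^ β) P := by
    refine Integrable.of_bound (C := d ^ β) (hVm.pow_const β).aestronglyMeasurable (Eventually.of_forall fun ω => ?_)
    rw [Real.norm_of_nonneg (Real.rpow_nonneg (hV0 ω) _)]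
    exact Real.rpow_le_rpow (hV0 ω) (min_le_right _ _) hβ.le
  have hprim : ∀ x : ℝ, ∫ t in (0 : ℝ)..x, β * t ^ (β - 1) = x ^ β := by
    intro x
    rw [intervalIntegral.integral_const_mul, integral_rpow (Or.inl (by linarith)), sub_add_cancel,
      Real.zero_rpow hβ.ne', sub_zero]
    field_simp
  -- Layer cake: the mean of `V ^ β` is the integral of `P(V ≥ t) β t^(β-1)` over `t > 0`.
  have hcake := lintegral_comp_eq_lintegral_meas_le_mul P (f := V) (g := fun t => β * t ^ (β - 1))
    (Eventually.of_forall hV0) hVm.aemeasurable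
    (fun t _ => (intervalIntegral.intervalIntegrable_rpow' (by linarith)).const_mul β)
    ((ae_restrict_iff' measurableSet_Ioi).2 (Eventually.of_forall fun t ht =>
      mul_nonneg hβ.le (Real.rpow_nonneg (le_of_lt ht) _)))
  simp only [hprim] at hcake
  obtain ⟨hTint, hTval⟩ := integral_upperGamma_mul_rpow hi0 hβ hd
  have hVtail : ∀ t ∈ Ioi (0 : ℝ), P {ω | t ≤ V ω} * ENNReal.ofReal (β * t ^ (β - 1)) =
      (Ioc 0 d).indicator (fun t => ENNReal.ofReal
        ((Real.Gamma i)⁻¹ * (upperGamma i t * (β * t ^ (β - 1))))) t := by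
    intro t ht
    have ht0 : 0 < t := ht
    by_cases htd : t ≤ d
    · rw [indicator_of_mem (show t ∈ Ioc 0 d from ⟨ht, htd⟩)]
      have hr : 0 < √(t / c) := Real.sqrt_pos.2 (by positivity)
      have hsq : c * √(t / c) ^ 2 = t := by
        rw [Real.sq_sqrt (by positivity)]; field_simp
      have hset : {ω | t ≤ V ω} = {ω | √(t / c) ≤ D ω} := by
        ext ω
        simp only [mem_ofPred_eq, V, le_min_iff, htd, and_true]
        rw [Real.sqrt_le_left (hD ω), div_le_iff₀ hc, mul_comm]
      rw [hset, htailD _ hr, hsq, ← ENNReal.ofReal_mul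
        (div_nonneg (upperGamma_nonneg _ ht0.le) hG.le)]
      congr 1
      ring
    · rw [indicator_of_notMem (fun h => htd h.2)]
      have hset : {ω | t ≤ V ω} = ∅ := by
        ext ω
        simp only [mem_ofPred_eq, V, le_min_iff, htd, and_false, mem_empty_iff_false]
      rw [hset, measure_empty, zero_mul]
  have hval : ∫ ω, V ω ^ β ∂P = (lowerGamma (i + β) d + d ^ β * upperGamma i d) /
      Real.Gamma i := by
    rw [integral_eq_lintegral_of_nonneg_ae
      (Eventually.of_forall fun ω => Real.rpow_nonneg (hV0 ω) _) hVint.1, hcake,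
      setLIntegral_congr_fun measurableSet_Ioi hVtail, lintegral_indicator measurableSet_Ioc,
      Measure.restrict_restrict measurableSet_Ioc,
      inter_eq_self_of_subset_left Ioc_subset_Ioi_self,
      ← integral_eq_lintegral_of_nonneg_ae _ (hTint.const_mul _).1, integral_const_mul, hTval]
    · ring
    · refine (ae_restrict_iff' measurableSet_Ioc).2 (Eventually.of_forall fun t ht => ?_)
      exact mul_nonneg (inv_nonneg.2 hG.le) (mul_nonneg (upperGamma_nonneg _ ht.1.le)
        (mul_nonneg hβ.le (Real.rpow_nonneg ht.1.le _)))
  simp only [hminV]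
  exact ⟨hVint.const_mul _, by rw [integral_const_mul, hval]⟩

/-! ### Counting points and comparing distances with a radius. -/

variable {Ω : Type*}

open Classical in
lemma pointCount_eq_iSup (X : ℕ → Ω → Plane) (ω : Ω) {B : Set Plane} (hB : MeasurableSet B) :
    pointCount X ω B = ⨆ s : Finset ℕ, ((s.filter fun n => X n ω ∈ B).card : ℝ≥0∞) := by
  rw [pointCount, Measure.sum_apply _ hB, ENNReal.tsum_eq_iSup_sum]
  refine iSup_congr fun s => ?_
  simp only [Measure.dirac_apply' _ hB, indicator_apply, Pi.one_apply, Finset.sum_ite,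
    Finset.sum_const_zero, add_zero, Finset.sum_const, nsmul_eq_mul, mul_one]

/-- Indices are counted, so coinciding points keep their multiplicity. Without `i` witnesses every
finite partial count is at most `i - 1`, hence so is their supremum. -/
lemma natCast_le_pointCount_iff (X : ℕ → Ω → Plane) (ω : Ω) {B : Set Plane}
    (hB : MeasurableSet B) (i : ℕ) :
    (i : ℝ≥0∞) ≤ pointCount X ω B ↔ ∃ s : Finset ℕ, s.card = i ∧ ∀ n ∈ s, X n ω ∈ B := by
  classical
  rw [pointCount_eq_iSup X ω hB]
  constructor
  · intro h
    by_contra! hno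
    have hlt : ∀ s : Finset ℕ, (s.filter fun n => X n ω ∈ B).card < i := by
      intro s
      by_contra! hs
      obtain ⟨t, ht, htc⟩ := Finset.exists_subset_card_eq hs
      obtain ⟨n, hn, hnB⟩ := hno t htc
      exact hnB (Finset.mem_filter.1 (ht hn)).2
    have hi : 0 < i := (Nat.zero_le _).trans_lt (hlt ∅)
    have hsup : (⨆ s : Finset ℕ, ((s.filter fun n => X n ω ∈ B).card : ℝ≥0∞)) ≤
        ((i - 1 : ℕ) : ℝ≥0∞) :=
      iSup_le fun s => Nat.cast_le.2 (Nat.le_sub_one_of_lt (hlt s))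
    have := Nat.cast_le.1 (h.trans hsup)
    omega
  · rintro ⟨s, rfl, hs⟩
    refine le_iSup_of_le s ?_
    rw [Finset.filter_true_of_mem hs]

lemma measurable_pointCount [MeasurableSpace Ω] {X : ℕ → Ω → Plane} (hX : ∀ n, Measurable (X n))
    {B : Set Plane} (hB : MeasurableSet B) : Measurable fun ω => pointCount X ω B := by
  simp only [pointCount, Measure.sum_apply _ hB]
  exact Measurable.tsum fun n =>
    (Measure.measurable_coe hB).comp (Measure.measurable_dirac.comp (hX n))

lemma nearestDist_nonneg (X : ℕ → Ω → Plane) (c : Plane) {i : ℕ} (hi : 1 ≤ i) (ω : Ω) :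
    0 ≤ nearestDist X c i ω := by
  refine Real.sInf_nonneg fun r hr => ?_
  by_contra! h
  rw [mem_ofPred_eq, Metric.closedBall_eq_empty.2 h, measure_empty] at hr
  have : i ≤ 0 := by exact_mod_cast hr
  omega

/-- The second alternative is the default `sInf ∅ = 0`, taken when no ball contains `i` points. Open
balls suit the strict inequality, since finitely many points of an open ball lie in a smaller closed
one. -/
lemma nearestDist_lt_iff (X : ℕ → Ω → Plane) (c : Plane) {i : ℕ} (hi : 1 ≤ i) (ω : Ω) {r : ℝ}
    (hr : 0 < r) : nearestDist X c i ω < r ↔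
      (i : ℝ≥0∞) ≤ pointCount X ω (Metric.ball c r) ∨
        ∀ n : ℕ, ¬ (i : ℝ≥0∞) ≤ pointCount X ω (Metric.ball c n) := by
  have hbdd : BddBelow {r : ℝ | (i : ℝ≥0∞) ≤ pointCount X ω (Metric.closedBall c r)} := by
    refine ⟨0, fun r hr => ?_⟩
    by_contra! h
    rw [mem_ofPred_eq, Metric.closedBall_eq_empty.2 h, measure_empty] at hr
    have : i ≤ 0 := by exact_mod_cast hr
    omega
  constructor
  · intro h
    by_cases hne : {r : ℝ | (i : ℝ≥0∞) ≤ pointCount X ω (Metric.closedBall c r)}.Nonempty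
    · obtain ⟨s, hs, hsr⟩ := exists_lt_of_csInf_lt hne h
      exact Or.inl (le_trans hs (measure_mono (Metric.closedBall_subset_ball hsr)))
    · refine Or.inr fun n hn => hne ⟨n, hn.trans (measure_mono Metric.ball_subset_closedBall)⟩
  · rintro (h | h)
    · obtain ⟨s, hsc, hs⟩ := (natCast_le_pointCount_iff X ω measurableSet_ball i).1 h
      have hsne : s.Nonempty := Finset.card_pos.1 (by omega)
      -- The farthest of the `i` witnesses gives an admissible radius still below `r`.
      obtain ⟨m, hm, hmax⟩ := s.exists_max_image (fun n => dist (X n ω) c) hsne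
      refine (csInf_le hbdd ?_).trans_lt (hs m hm)
      exact (natCast_le_pointCount_iff X ω measurableSet_closedBall i).2 ⟨s, hsc, hmax⟩
    · have hempty : {r : ℝ | (i : ℝ≥0∞) ≤ pointCount X ω (Metric.closedBall c r)} = ∅ := by
        refine eq_empty_of_forall_notMem fun s hs => ?_
        obtain ⟨n, hn⟩ := exists_nat_gt s
        exact h n (le_trans hs (measure_mono (Metric.closedBall_subset_ball hn)))
      rw [nearestDist, hempty, Real.sInf_empty]
      exact hr

/-- The second alternative is the default value `0` of `Metric.infDist` to the empty set, when the
label never occurs. -/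
lemma labelDist_lt_iff {k : ℕ} (X : ℕ → Ω → Plane) (L : ℕ → Ω → Fin k) (c : Plane) (t : Fin k)
    (ω : Ω) {r : ℝ} (hr : 0 < r) : labelDist X L c t ω < r ↔
      (∃ n, L n ω = t ∧ X n ω ∈ Metric.ball c r) ∨
        ∀ m : ℕ, ¬ ∃ n, L n ω = t ∧ X n ω ∈ Metric.ball c m := by
  by_cases hne : {y | ∃ n, L n ω = t ∧ X n ω = y}.Nonempty
  · rw [labelDist, Metric.infDist_lt_iff hne]
    constructor
    · rintro ⟨y, ⟨n, hn, rfl⟩, hy⟩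
      exact Or.inl ⟨n, hn, by rwa [Metric.mem_ball']⟩
    · rintro (⟨n, hn, hy⟩ | h)
      · exact ⟨X n ω, ⟨n, hn, rfl⟩, by rwa [Metric.mem_ball'] at hy⟩
      · obtain ⟨y, n, hn, rfl⟩ := hne
        obtain ⟨m, hm⟩ := exists_nat_gt (dist (X n ω) c)
        exact absurd ⟨n, hn, hm⟩ (h m)
  · rw [labelDist, not_nonempty_iff_eq_empty.1 hne, Metric.infDist_empty]
    refine iff_of_true hr (Or.inr fun m => ?_)
    rintro ⟨n, hn, -⟩
    exact hne ⟨_, n, hn, rfl⟩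

/-! ### Poisson probabilities and thinning by labels. -/

section Poisson

variable [MeasurableSpace Ω] {P : Measure Ω} {X : ℕ → Ω → Plane} {lam : ℝ}

lemma IsHomogeneousPoisson.hasLaw_ball (hX : IsHomogeneousPoisson P X lam) (hlam : 0 < lam)
    (c : Plane) {r : ℝ} (hr : 0 ≤ r) :
    HasLaw (fun ω => pointCount X ω (Metric.ball c r))
      ((poissonMeasure (lam * Real.pi * r ^ 2).toNNReal).map (Nat.cast : ℕ → ℝ≥0∞)) P := by
  have h := hX.poisson (Metric.ball c r) measurableSet_ball measure_ball_lt_top.ne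
  rwa [EuclideanSpace.volume_ball_fin_two, ← ENNReal.ofReal_pow hr,
    ← ENNReal.ofReal_mul (by positivity), ← ENNReal.ofReal_mul hlam.le, ENNReal.ofReal, ENNReal.toNNReal_coe,
    show lam * (r ^ 2 * Real.pi) = lam * Real.pi * r ^ 2 by ring] at h

lemma IsHomogeneousPoisson.measure_pointCount_lt (hX : IsHomogeneousPoisson P X lam)
    (hlam : 0 < lam) (c : Plane) {i : ℕ} (hi : 1 ≤ i) {r : ℝ} (hr : 0 ≤ r) :
    P {ω | pointCount X ω (Metric.ball c r) < i} =
      ENNReal.ofReal (upperGamma i (lam * Real.pi * r ^ 2) / Real.Gamma i) := by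
  have h := hX.hasLaw_ball hlam c hr
  have hu : 0 ≤ lam * Real.pi * r ^ 2 := by positivity
  have h1 : P {ω | pointCount X ω (Metric.ball c r) < i} =
      P.map (fun ω => pointCount X ω (Metric.ball c r)) (Iio (i : ℝ≥0∞)) := by
    rw [Measure.map_apply_of_aemeasurable h.aemeasurable measurableSet_Iio]; rfl
  have h2 : (Nat.cast : ℕ → ℝ≥0∞) ⁻¹' Iio (i : ℝ≥0∞) = (Finset.range i : Set ℕ) := by
    ext n; simp
  rw [h1, h.map_eq, Measure.map_apply measurable_from_top measurableSet_Iio, h2,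
    ← sum_measure_singleton, upperGamma_natCast_div hi hu,
    ENNReal.ofReal_sum_of_nonneg fun j _ => by positivity]
  refine Finset.sum_congr rfl fun j _ => ?_
  rw [poissonMeasure_singleton, Real.coe_toNNReal _ hu]

/-- The generating function of the Poisson law, summed from the exponential series; a real exponent
is used because counts take values in `ℝ≥0∞`. -/
lemma lintegral_rpow_poissonMeasure (u : NNReal) {q : ℝ} (hq : 0 ≤ q) :
    ∫⁻ x, ENNReal.ofReal q ^ x.toReal ∂((poissonMeasure u).map (Nat.cast : ℕ → ℝ≥0∞)) =
      ENNReal.ofReal (Real.exp (-(u * (1 - q)))) := by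
  have hs : HasSum (fun n : ℕ => Real.exp (-u) * u ^ n / (n.factorial : ℝ) * q ^ n)
      (Real.exp (-(u * (1 - q)))) := by
    have h := (NormedSpace.expSeries_div_hasSum_exp ((u : ℝ) * q)).mul_left (Real.exp (-u))
    rw [← Real.exp_eq_exp_ℝ, ← Real.exp_add] at h
    rw [show -((u : ℝ) * (1 - q)) = -u + u * q by ring]
    refine h.congr_fun fun n => ?_
    rw [mul_pow]; ring
  rw [lintegral_map (by fun_prop) measurable_from_top, poissonMeasure, lintegral_sum_measure]
  simp only [lintegral_smul_measure, lintegral_dirac, smul_eq_mul, ENNReal.toReal_natCast,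
    ENNReal.rpow_natCast]
  rw [← hs.tsum_eq, ENNReal.ofReal_tsum_of_nonneg (fun n => by positivity) hs.summable]
  refine tsum_congr fun n => ?_
  rw [← ENNReal.ofReal_pow hq, ← ENNReal.ofReal_mul (by positivity)]

lemma IsUniformLabelling.measure_forall_ne [IsProbabilityMeasure P] {k : ℕ} {L : ℕ → Ω → Fin k}
    (hL : IsUniformLabelling P X L) (hk : 1 ≤ k) (t : Fin k) (s : Finset ℕ) :
    P {ω | ∀ n ∈ s, L n ω ≠ t} = ENNReal.ofReal (1 - (k : ℝ)⁻¹) ^ s.card := by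
  have hset : {ω | ∀ n ∈ s, L n ω ≠ t} = ⋂ n ∈ s, L n ⁻¹' {t}ᶜ := by ext; simp
  have hk0 : (0 : ℝ) < k := by exact_mod_cast hk
  rw [hset, hL.indep.measure_inter_preimage_eq_mul s fun _ _ => MeasurableSet.of_discrete,
    Finset.prod_congr rfl fun n _ => ?_, Finset.prod_const]
  rw [preimage_compl, prob_compl_eq_one_sub (hL.measurable n MeasurableSet.of_discrete)]
  have := hL.uniform n t
  change 1 - P {ω | L n ω = t} = _
  rw [this, ENNReal.ofReal_sub _ (by positivity), ENNReal.ofReal_one,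
    ENNReal.ofReal_inv_of_pos hk0, ENNReal.ofReal_natCast]

/-- Condition on the positions: if the ball holds `N` caches, all of them miss label `t` with
probability `(1 - 1/k)^N`. Averaging over the Poisson variable `N` is its generating function at `1
- 1/k`. -/
lemma IsHomogeneousPoisson.measure_no_label [IsProbabilityMeasure P]
    (hX : IsHomogeneousPoisson P X lam) (hlam : 0 < lam) {k : ℕ} (hk : 1 ≤ k)
    {L : ℕ → Ω → Fin k} (hL : IsUniformLabelling P X L) (c : Plane) (t : Fin k) {r : ℝ}
    (hr : 0 ≤ r) :
    P {ω | ∃ n, L n ω = t ∧ X n ω ∈ Metric.ball c r}ᶜ =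
      ENNReal.ofReal (Real.exp (-(lam * Real.pi * r ^ 2 * (k : ℝ)⁻¹))) := by
  classical
  have hk1 : (1 : ℝ) ≤ k := by exact_mod_cast hk
  have hq : 0 ≤ 1 - (k : ℝ)⁻¹ := sub_nonneg.2 (inv_le_one_of_one_le₀ hk1)
  have hXm : Measurable fun ω n => X n ω := measurable_pi_lambda _ hX.measurable
  have hLm : Measurable fun ω n => L n ω := measurable_pi_lambda _ hL.measurable
  let A : Set ((ℕ → Plane) × (ℕ → Fin k)) := {p | ∀ n, p.1 n ∈ Metric.ball c r → p.2 n ≠ t}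
  have hA : MeasurableSet A := by
    have : A = ⋂ n, ({p | p.1 n ∈ Metric.ball c r}ᶜ ∪ {p | p.2 n = t}ᶜ) := by
      ext p; simp only [A, mem_ofPred_eq, mem_iInter, mem_union, mem_compl_iff]
      exact forall_congr' fun n => imp_iff_not_or
    rw [this]
    refine MeasurableSet.iInter fun n => MeasurableSet.union ?_ ?_
    · exact (measurableSet_ball.preimage ((measurable_pi_apply n).comp measurable_fst)).compl
    · exact ((MeasurableSet.of_discrete (s := ({t} : Set (Fin k)))).preimage
        ((measurable_pi_apply n).comp measurable_snd)).compl
  have hlaw := hX.hasLaw_ball hlam c hr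
  have hfin : ∀ᵐ ω ∂P, pointCount X ω (Metric.ball c r) ≠ ∞ := by
    have : ∀ᵐ x ∂(P.map fun ω => pointCount X ω (Metric.ball c r)), x ≠ ∞ := by
      rw [hlaw.map_eq]
      refine (ae_map_iff measurable_from_top.aemeasurable (measurableSet_singleton ∞).compl).2 ?_
      simp
    exact ae_of_ae_map hlaw.aemeasurable this
  have hset : {ω | ∃ n, L n ω = t ∧ X n ω ∈ Metric.ball c r}ᶜ =
      (fun ω => ((fun n => X n ω), fun n => L n ω)) ⁻¹' A := by
    ext ω
    simp only [A, mem_compl_iff, mem_ofPred_eq, mem_preimage, not_exists, not_and]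
    exact forall_congr' fun n => ⟨fun h h1 h2 => h h2 h1, fun h h1 h2 => h h2 h1⟩
  -- Independence makes the joint law of positions and labels a product, so Tonelli allows fixing
  -- the positions first.
  rw [hset, ← Measure.map_apply (hXm.prodMk hLm) hA,
    (indepFun_iff_map_prod_eq_prod_map_map hXm.aemeasurable hLm.aemeasurable).1 hL.indep_position,
    Measure.prod_apply hA, lintegral_map (measurable_measure_prodMk_left hA) hXm]
  have hcond : ∀ᵐ ω ∂P, (P.map fun ω n => L n ω) (Prod.mk (fun n => X n ω) ⁻¹' A) =
      ENNReal.ofReal (1 - (k : ℝ)⁻¹) ^ (pointCount X ω (Metric.ball c r)).toReal := by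
    filter_upwards [hfin] with ω hω
    have hfinite : {n | X n ω ∈ Metric.ball c r}.Finite := by
      by_contra hinf
      -- Infinitely many indices in the ball would make the count exceed every finite bound.
      refine hω (ENNReal.eq_top_of_forall_nnreal_le fun x => ?_)
      obtain ⟨m, hm⟩ := exists_nat_ge x
      obtain ⟨s, hs, hsc⟩ := Set.Infinite.exists_subset_card_eq hinf m
      refine le_trans (b := (m : ℝ≥0∞)) (by exact_mod_cast hm) ?_
      exact (natCast_le_pointCount_iff X ω measurableSet_ball m).2 ⟨s, hsc, fun n hn => hs hn⟩
    have hcount : pointCount X ω (Metric.ball c r) = (hfinite.toFinset.card : ℝ≥0∞) := by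
      refine le_antisymm ?_ ?_
      · rw [pointCount_eq_iSup X ω measurableSet_ball]
        refine iSup_le fun s => Nat.cast_le.2 (Finset.card_le_card fun n hn => ?_)
        simpa using (Finset.mem_filter.1 hn).2
      · exact (natCast_le_pointCount_iff X ω measurableSet_ball _).2
          ⟨_, rfl, fun n hn => hfinite.mem_toFinset.1 hn⟩
    rw [Measure.map_apply hLm (measurable_prodMk_left hA), hcount, ENNReal.toReal_natCast,
      ENNReal.rpow_natCast, ← hL.measure_forall_ne hk t]
    congr 1
    ext ω'
    simp [A]
  have hu : 0 ≤ lam * Real.pi * r ^ 2 := by positivity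
  rw [lintegral_congr_ae hcond, ← lintegral_map' (μ := P)
    (f := fun x : ℝ≥0∞ => ENNReal.ofReal (1 - (k : ℝ)⁻¹) ^ x.toReal) (by fun_prop)
    hlaw.aemeasurable, hlaw.map_eq, lintegral_rpow_poissonMeasure _ hq, Real.coe_toNNReal _ hu,
    sub_sub_cancel]

end Poisson

/-! ### Expected costs of the two strategies. -/

lemma integral_partitionCost {Ω : Type*} [MeasurableSpace Ω] {P : Measure Ω}
    [IsProbabilityMeasure P] {X : ℕ → Ω → Plane} {lam : ℝ} (hlam : 0 < lam)
    (hX : IsHomogeneousPoisson P X lam) (c : Plane) {k : ℕ} (hk : 1 ≤ k) {a δmax : ℝ} (ha : 0 < a)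
    (hδ : 0 ≤ δmax) {L : ℕ → Ω → Fin k} (hL : IsUniformLabelling P X L) :
    Integrable (partitionCost X L c a δmax) P ∧
    ∫ ω, partitionCost X L c a δmax ω ∂P = k * ((k / (lam * Real.pi)) ^ (a / 2) *
      (lowerGamma (a / 2 + 1) (lam * Real.pi * δmax ^ 2 / k) +
        (lam * Real.pi * δmax ^ 2 / k) ^ (a / 2) *
          upperGamma 1 (lam * Real.pi * δmax ^ 2 / k))) := by
  have hk0 : (0 : ℝ) < k := by exact_mod_cast hk
  have key (t : Fin k) := integral_min_rpow_of_tail (P := P) (D := labelDist X L c t)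
    (E := fun r => {ω | ∃ n, L n ω = t ∧ X n ω ∈ Metric.ball c r}) (i := 1) le_rfl
    (c := lam * Real.pi / k) (by positivity) (fun ω => Metric.infDist_nonneg)
    (fun r => by
      have : {ω | ∃ n, L n ω = t ∧ X n ω ∈ Metric.ball c r} =
          ⋃ n, L n ⁻¹' {t} ∩ X n ⁻¹' Metric.ball c r := by ext; simp
      rw [this]
      exact MeasurableSet.iUnion fun n => (hL.measurable n MeasurableSet.of_discrete).inter
        (hX.measurable n measurableSet_ball))
    (fun r hr => by
      ext ω
      rw [Set.mem_ofPred_eq, labelDist_lt_iff X L c t ω hr, Set.mem_union, Set.mem_iInter]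
      rfl)
    (fun r hr => by
      rw [hX.measure_no_label hlam hk hL c t hr.le, Nat.cast_one, Real.Gamma_one, div_one,
        upperGamma_one]
      congr 3
      ring)
    ha hδ
  refine ⟨integrable_finsetSum Finset.univ fun t _ => (key t).1, ?_⟩
  simp only [partitionCost, waitingCost]
  rw [integral_finsetSum _ fun t _ => (key t).1]
  simp only [fun t => (key t).2, Finset.sum_const, Finset.card_univ, Fintype.card_fin,
    nsmul_eq_mul, Nat.cast_one, Real.Gamma_one, div_one, inv_div, add_comm (1 : ℝ)]
  rw [div_mul_eq_mul_div]

lemma integral_nearestCost {Ω : Type*} [MeasurableSpace Ω] {P : Measure Ω}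
    [IsProbabilityMeasure P] {X : ℕ → Ω → Plane} {lam : ℝ} (hlam : 0 < lam)
    (hX : IsHomogeneousPoisson P X lam) (c : Plane) (k : ℕ) {a δmax : ℝ} (ha : 0 < a)
    (hδ : 0 ≤ δmax) :
    Integrable (nearestCost X c k a δmax) P ∧
    ∫ ω, nearestCost X c k a δmax ω ∂P = (lam * Real.pi)⁻¹ ^ (a / 2) *
      ∑ i ∈ Finset.range k, (lowerGamma ((i + 1 : ℕ) + a / 2) (lam * Real.pi * δmax ^ 2) +
        (lam * Real.pi * δmax ^ 2) ^ (a / 2) * upperGamma (i + 1 : ℕ) (lam * Real.pi * δmax ^ 2)) /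
          Real.Gamma (i + 1 : ℕ) := by
  have key (i : ℕ) := integral_min_rpow_of_tail (P := P) (D := nearestDist X c (i + 1))
    (E := fun r => {ω | ((i + 1 : ℕ) : ℝ≥0∞) ≤ pointCount X ω (Metric.ball c r)}) (i := i + 1)
    (Nat.le_add_left 1 i) (c := lam * Real.pi) (by positivity)
    (nearestDist_nonneg X c (Nat.le_add_left 1 i))
    (fun r => measurableSet_le measurable_const
      (measurable_pointCount hX.measurable measurableSet_ball))
    (fun r hr => by
      ext ω
      rw [Set.mem_ofPred_eq, nearestDist_lt_iff X c (Nat.le_add_left 1 i) ω hr, Set.mem_union,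
        Set.mem_iInter]
      rfl)
    (fun r hr => by
      rw [← hX.measure_pointCount_lt hlam c (Nat.le_add_left 1 i) hr.le]
      congr 1
      ext ω
      simp)
    ha hδ
  refine ⟨integrable_finsetSum Finset.univ fun (i : Fin k) _ => (key i).1, ?_⟩
  simp only [nearestCost, waitingCost]
  rw [integral_finsetSum _ fun (i : Fin k) _ => (key i).1, Finset.mul_sum, ← Fin.sum_univ_eq_sum_range
    (fun i : ℕ => (lam * Real.pi)⁻¹ ^ (a / 2) *
      ((lowerGamma ((i + 1 : ℕ) + a / 2) (lam * Real.pi * δmax ^ 2) +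
        (lam * Real.pi * δmax ^ 2) ^ (a / 2) * upperGamma (i + 1 : ℕ) (lam * Real.pi * δmax ^ 2)) /
          Real.Gamma (i + 1 : ℕ)))]
  exact Finset.sum_congr rfl fun i _ => (key i).2

end WirelessCaches

end

theorem theorem3 {Ω : Type*} [MeasurableSpace Ω] (P : Measure Ω) [IsProbabilityMeasure P]
    (X : ℕ → Ω → WirelessCaches.Plane) (lam : ℝ) (hlam : 0 < lam)
    (hX : WirelessCaches.IsHomogeneousPoisson P X lam)
    (c : WirelessCaches.Plane) (k : ℕ) (hk : 1 ≤ k)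
    (a δmax : ℝ) (ha : 0 < a) (hδ : 0 ≤ δmax)
    (b d : ℝ) (hb : b = a / 2 + 1) (hd : d = lam * Real.pi * δmax ^ 2) :
    (∀ L : ℕ → Ω → Fin k, WirelessCaches.IsUniformLabelling P X L →
      Integrable (WirelessCaches.partitionCost X L c a δmax) P ∧
      ∫ ω, WirelessCaches.partitionCost X L c a δmax ω ∂P =
        (k : ℝ) * ((k : ℝ) / (lam * Real.pi)) ^ (b - 1) *
            WirelessCaches.lowerGamma b (d / (k : ℝ)) +
          (k : ℝ) * (d / (lam * Real.pi)) ^ (b - 1) *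
            WirelessCaches.upperGamma 1 (d / (k : ℝ))) ∧
    Integrable (WirelessCaches.nearestCost X c k a δmax) P ∧
    ∫ ω, WirelessCaches.nearestCost X c k a δmax ω ∂P =
      (WirelessCaches.lowerGamma ((k : ℝ) + b) d +
          b * d ^ (b - 1) * WirelessCaches.upperGamma ((k : ℝ) + 1) d -
          (b - 1) * d ^ b * WirelessCaches.upperGamma (k : ℝ) d) /
        ((lam * Real.pi) ^ (b - 1) * b * Real.Gamma (k : ℝ)) := by
  have hk0 : (0 : ℝ) < k := by exact_mod_cast hk
  have hG := (Real.Gamma_pos_of_pos hk0).ne'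
  have hlp : 0 < lam * Real.pi := by positivity
  have hd0 : 0 ≤ d := by rw [hd]; positivity
  have hb1 : b - 1 = a / 2 := by rw [hb]; ring
  refine ⟨fun L hL => ?_, ?_⟩
  · obtain ⟨hint, hval⟩ := WirelessCaches.integral_partitionCost hlam hX c hk ha hδ hL
    refine ⟨hint, ?_⟩
    -- Separates the scale `k/(λπ)` of the thinned process from its truncation parameter `d/k`.
    have hsplit : (d / (lam * Real.pi)) ^ (a / 2) =
        (k / (lam * Real.pi)) ^ (a / 2) * (d / k) ^ (a / 2) := by
      rw [← Real.mul_rpow (by positivity) (by positivity)]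
      congr 1
      field_simp
    rw [hval, ← hd, ← hb, hb1, hsplit]
    ring
  · obtain ⟨hint, hval⟩ := WirelessCaches.integral_nearestCost hlam hX c k ha hδ
    refine ⟨hint, ?_⟩
    rw [hval, ← hd, WirelessCaches.sum_lowerGamma_add_upperGamma hk (by positivity) hd0, hb1, ← hb,
      Real.inv_rpow hlp.le]
    have hb0 : b ≠ 0 := by rw [hb]; positivity
    have hr : (lam * Real.pi) ^ (a / 2) ≠ 0 := (Real.rpow_pos_of_pos hlp _).ne'
    field_simp
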